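/- Let $f:\mathbb{R}^n\to\mathbb{R}$. A sequence $(x_k)_{k\ge 0}$ in $\mathbb{R}^n$ is called a BFGS sequence for $f$ if $f$ is differentiable at each $x_k$ with $\nabla f(x_k)\neq 0$, and there exist real parameters $0<\mu<\nu<1$ and a (symmetric) positive definite $n\times n$ matrix $H_0$ such that the vectors $$s_k=x_{k+1}-x_k,\qquad y_k=\nabla f(x_{k+1})-\nabla f(x_k)$$ and the matrices defined recursively by $$V_k=I-\frac{s_ky_k^T}{s_k^Ty_k},\qquad H_{k+1}=V_kH_kV_k^T+\frac{s_ks_k^T}{s_k^Ty_k}$$ satisfy, for all $k=0,1,2,\ldots$, $$H_k\nabla f(x_k)\in-\mathbb{R}_+s_k,\qquad f(x_{k+1})\le f(x_k)+\mu\,\nabla f(x_k)^Ts_k,\qquad \nabla f(x_{k+1})^Ts_k\ge\nu\,\nabla f(x_k)^Ts_k.$$ (These conditions imply $s_k^Ty_k>0$ for all $k$, so the matrices $H_k$ are well defined.) **Corollary.** Every BFGS sequence for the function $f:\mathbb{R}^2\to\mathbb{R}$ given by $f(u,v)=u^2+|v|$ has a subsequence converging to a point on the line $v=0$. -/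

import Mathlib

open Filter Topology
open scoped Matrix

noncomputable section

/-- One BFGS update of the approximate inverse Hessian `H`, for the step `s` and the gradient
increment `y`: `V H Vᵀ + s sᵀ / (sᵀ y)`, where `V = I - s yᵀ / (sᵀ y)`. -/
def bfgsUpdate {n : ℕ} (s y : Fin n → ℝ) (H : Matrix (Fin n) (Fin n) ℝ) :
    Matrix (Fin n) (Fin n) ℝ :=
  (1 - (s ⬝ᵥ y)⁻¹ • Matrix.vecMulVec s y) * H * (1 - (s ⬝ᵥ y)⁻¹ • Matrix.vecMulVec s y)ᵀ
    + (s ⬝ᵥ y)⁻¹ • Matrix.vecMulVec s s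

/-- The approximate inverse Hessians `H₀, H₁, H₂, …` generated from `H₀` by the BFGS updates with
steps `s k` and gradient increments `y k`. -/
def bfgsMatrix {n : ℕ} (s y : ℕ → Fin n → ℝ) (H₀ : Matrix (Fin n) (Fin n) ℝ) :
    ℕ → Matrix (Fin n) (Fin n) ℝ
  | 0 => H₀
  | k + 1 => bfgsUpdate (s k) (y k) (bfgsMatrix s y H₀ k)

/-- The step `s k = x (k + 1) - x k`. -/
def bfgsStep {n : ℕ} (x : ℕ → EuclideanSpace ℝ (Fin n)) (k : ℕ) : Fin n → ℝ :=
  (x (k + 1) - x k).ofLp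

/-- The gradient increment `y k = ∇f (x (k + 1)) - ∇f (x k)`. -/
def bfgsGradStep {n : ℕ} (f : EuclideanSpace ℝ (Fin n) → ℝ)
    (x : ℕ → EuclideanSpace ℝ (Fin n)) (k : ℕ) : Fin n → ℝ :=
  (gradient f (x (k + 1)) - gradient f (x k)).ofLp

/-- `x` is a BFGS sequence for `f`: at every iterate `f` is differentiable with nonzero gradient,
and for some parameters `0 < μ < ν < 1` and some symmetric positive definite `H₀`, every step
satisfies the direction condition `H k ∇f (x k) ∈ -ℝ₊ (s k)`,
the Armijo condition and the weak Wolfe condition. -/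
def IsBFGSSequence {n : ℕ} (f : EuclideanSpace ℝ (Fin n) → ℝ)
    (x : ℕ → EuclideanSpace ℝ (Fin n)) : Prop :=
  (∀ k, DifferentiableAt ℝ f (x k) ∧ gradient f (x k) ≠ 0) ∧
  ∃ μ ν : ℝ, 0 < μ ∧ μ < ν ∧ ν < 1 ∧
  ∃ H₀ : Matrix (Fin n) (Fin n) ℝ, H₀.PosDef ∧
  ∀ k : ℕ,
    (∃ t : ℝ, 0 ≤ t ∧
      bfgsMatrix (bfgsStep x) (bfgsGradStep f x) H₀ k *ᵥ (gradient f (x k)).ofLp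
        = -(t • bfgsStep x k)) ∧
    f (x (k + 1)) ≤ f (x k) + μ * ((gradient f (x k)).ofLp ⬝ᵥ bfgsStep x k) ∧
    ν * ((gradient f (x k)).ofLp ⬝ᵥ bfgsStep x k)
      ≤ (gradient f (x (k + 1))).ofLp ⬝ᵥ bfgsStep x k

end

/-! Otherwise the iterates, confined to a bounded sublevel set, eventually satisfy `|v| ≥ δ`. There
the gradient `(2u, ±1)` has norm at least 1, and `yᵀy ≤ (2 + 1/δ) sᵀy` even when a step crosses the
line. Powell's argument rules this out. Put `B = H⁻¹` and follow `tr B - log det B ≥ 0`: each update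
adds at most a constant plus `log (-gᵀs)` (`bfgsPotential_bfgsUpdate_le`). As `f` is bounded below,
the Armijo condition forces `-gᵀs → 0`, so the potential tends to `-∞`, a contradiction. -/

/-! ### Algebra of the update and its potential. -/

section Update

variable {n : ℕ}

/-- The update of the approximate Hessian `B` that is dual to `bfgsUpdate`. -/
noncomputable def bfgsDualUpdate (s y : Fin n → ℝ) (B : Matrix (Fin n) (Fin n) ℝ) : Matrix (Fin n) (Fin n) ℝ :=
  B - (s ⬝ᵥ B *ᵥ s)⁻¹ • Matrix.vecMulVec (B *ᵥ s) (B *ᵥ s)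
    + (s ⬝ᵥ y)⁻¹ • Matrix.vecMulVec y y

theorem trace_bfgsDualUpdate (s y : Fin n → ℝ) (B : Matrix (Fin n) (Fin n) ℝ) :
    (bfgsDualUpdate s y B).trace
      = B.trace - (s ⬝ᵥ B *ᵥ s)⁻¹ * ((B *ᵥ s) ⬝ᵥ (B *ᵥ s)) + (s ⬝ᵥ y)⁻¹ * (y ⬝ᵥ y) := by
  simp [bfgsDualUpdate, Matrix.trace_add, Matrix.trace_sub, Matrix.trace_smul,
    Matrix.trace_vecMulVec]

/-- The secant equation `sᵀB⁺ = yᵀ` makes `Vᵀ` cancel the `yyᵀ` term of `B⁺`, while `Vs = 0` removes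
the other correction. -/
theorem bfgsUpdate_mul_bfgsDualUpdate {s y : Fin n → ℝ} {H B : Matrix (Fin n) (Fin n) ℝ}
    (hHB : H * B = 1) (hB : Bᵀ = B) (hsy : s ⬝ᵥ y ≠ 0) (hsB : s ⬝ᵥ B *ᵥ s ≠ 0) :
    bfgsUpdate s y H * bfgsDualUpdate s y B = 1 := by
  have hvB : s ᵥ* B = B *ᵥ s := by rw [← Matrix.mulVec_transpose, hB]
  have hHBs : H *ᵥ (B *ᵥ s) = s := by rw [Matrix.mulVec_mulVec, hHB, Matrix.one_mulVec]
  have hcomm : y ⬝ᵥ s = s ⬝ᵥ y := dotProduct_comm _ _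
  have hs : s ᵥ* bfgsDualUpdate s y B = y := by
    simp only [bfgsDualUpdate, Matrix.vecMul_add, Matrix.vecMul_sub, Matrix.vecMul_smul,
      Matrix.vecMul_vecMulVec, hvB, smul_smul]
    rw [inv_mul_cancel₀ hsB, inv_mul_cancel₀ hsy]
    simp
  have h1 : (1 - (s ⬝ᵥ y)⁻¹ • Matrix.vecMulVec s y)ᵀ * bfgsDualUpdate s y B
      = B - (s ⬝ᵥ B *ᵥ s)⁻¹ • Matrix.vecMulVec (B *ᵥ s) (B *ᵥ s) := by
    rw [Matrix.transpose_sub, Matrix.transpose_smul, Matrix.transpose_vecMulVec,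
      Matrix.transpose_one, sub_mul, one_mul, Matrix.smul_mul, Matrix.vecMulVec_mul, hs,
      bfgsDualUpdate, add_sub_cancel_right]
  have h2 : H * (B - (s ⬝ᵥ B *ᵥ s)⁻¹ • Matrix.vecMulVec (B *ᵥ s) (B *ᵥ s))
      = 1 - (s ⬝ᵥ B *ᵥ s)⁻¹ • Matrix.vecMulVec s (B *ᵥ s) := by
    rw [mul_sub, hHB, Matrix.mul_smul, Matrix.mul_vecMulVec, hHBs]
  have h3 : (1 - (s ⬝ᵥ y)⁻¹ • Matrix.vecMulVec s y) *ᵥ s = 0 := by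
    rw [Matrix.sub_mulVec, Matrix.one_mulVec, Matrix.smul_mulVec, Matrix.vecMulVec_mulVec, hcomm]
    simp [smul_smul, hsy]
  rw [bfgsUpdate, add_mul, mul_assoc, mul_assoc, h1, h2, mul_sub, mul_one, Matrix.mul_smul,
    Matrix.mul_vecMulVec, h3, Matrix.smul_mul, Matrix.vecMulVec_mul, hs]
  simp

/-- The update is `B (1 + UW)` with `UW` of rank at most two, so `det (1 + UW) = det (1 + WU)`
reduces to a 2 × 2 determinant. -/
theorem det_bfgsDualUpdate {s y : Fin n → ℝ} {H B : Matrix (Fin n) (Fin n) ℝ}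
    (hBH : B * H = 1) (hB : Bᵀ = B) (hsy : s ⬝ᵥ y ≠ 0) (hsB : s ⬝ᵥ B *ᵥ s ≠ 0) :
    (bfgsDualUpdate s y B).det = B.det * ((s ⬝ᵥ y) / (s ⬝ᵥ B *ᵥ s)) := by
  let U : Matrix (Fin n) (Fin 2) ℝ := Matrix.of fun i j => ![s i, (H *ᵥ y) i] j
  let W : Matrix (Fin 2) (Fin n) ℝ :=
    Matrix.of ![-(s ⬝ᵥ B *ᵥ s)⁻¹ • (B *ᵥ s), (s ⬝ᵥ y)⁻¹ • y]
  have hUW : U * W = -(s ⬝ᵥ B *ᵥ s)⁻¹ • Matrix.vecMulVec s (B *ᵥ s)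
      + (s ⬝ᵥ y)⁻¹ • Matrix.vecMulVec (H *ᵥ y) y := by
    ext i j
    simp [U, W, Matrix.mul_apply, Fin.sum_univ_two, Matrix.vecMulVec_apply]
    ring
  have hfac : bfgsDualUpdate s y B = B * (1 + U * W) := by
    rw [hUW, mul_add, mul_add, mul_one, Matrix.mul_smul, Matrix.mul_smul, Matrix.mul_vecMulVec,
      Matrix.mul_vecMulVec, Matrix.mulVec_mulVec, hBH, Matrix.one_mulVec, bfgsDualUpdate,
      neg_smul, sub_eq_add_neg, add_assoc]
  have hBsH : (B *ᵥ s) ⬝ᵥ (H *ᵥ y) = s ⬝ᵥ y := by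
    rw [← Matrix.vecMul_transpose, hB, ← Matrix.dotProduct_mulVec, Matrix.mulVec_mulVec, hBH,
      Matrix.one_mulVec]
  have e00 : (W * U) 0 0 = -1 := by
    have : (W * U) 0 0 = (-(s ⬝ᵥ B *ᵥ s)⁻¹ • (B *ᵥ s)) ⬝ᵥ s := rfl
    rw [this, smul_dotProduct, dotProduct_comm _ s, smul_eq_mul, neg_mul, inv_mul_cancel₀ hsB]
  have e01 : (W * U) 0 1 = -((s ⬝ᵥ y) / (s ⬝ᵥ B *ᵥ s)) := by
    have : (W * U) 0 1 = (-(s ⬝ᵥ B *ᵥ s)⁻¹ • (B *ᵥ s)) ⬝ᵥ (H *ᵥ y) := rfl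
    rw [this, smul_dotProduct, hBsH, smul_eq_mul]
    ring
  have e10 : (W * U) 1 0 = 1 := by
    have : (W * U) 1 0 = ((s ⬝ᵥ y)⁻¹ • y) ⬝ᵥ s := rfl
    rw [this, smul_dotProduct, dotProduct_comm _ s, smul_eq_mul, inv_mul_cancel₀ hsy]
  rw [hfac, Matrix.det_mul, Matrix.det_one_add_mul_comm, Matrix.det_fin_two]
  simp [Matrix.add_apply, e00, e01, e10]

theorem posDef_bfgsUpdate {s y : Fin n → ℝ} {H : Matrix (Fin n) (Fin n) ℝ}
    (hH : H.PosDef) (hsy : 0 < s ⬝ᵥ y) : (bfgsUpdate s y H).PosDef := by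
  have hT : Hᵀ = H := by simpa [Matrix.conjTranspose_eq_transpose_of_trivial] using hH.isHermitian.eq
  refine Matrix.PosDef.of_dotProduct_mulVec_pos ?_ fun z hz => ?_
  · rw [Matrix.IsHermitian, Matrix.conjTranspose_eq_transpose_of_trivial, bfgsUpdate,
      Matrix.transpose_add, Matrix.transpose_mul, Matrix.transpose_mul, Matrix.transpose_transpose,
      Matrix.transpose_smul, Matrix.transpose_vecMulVec, hT, Matrix.mul_assoc]
  · set V := 1 - (s ⬝ᵥ y)⁻¹ • Matrix.vecMulVec s y with hV
    have hVz : Vᵀ *ᵥ z = z - ((s ⬝ᵥ y)⁻¹ * (s ⬝ᵥ z)) • y := by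
      rw [hV, Matrix.transpose_sub, Matrix.transpose_smul, Matrix.transpose_vecMulVec,
        Matrix.transpose_one, Matrix.sub_mulVec, Matrix.one_mulVec, Matrix.smul_mulVec,
        Matrix.vecMulVec_mulVec]
      simp [smul_smul]
    have hexp : star z ⬝ᵥ (bfgsUpdate s y H *ᵥ z)
        = (Vᵀ *ᵥ z) ⬝ᵥ (H *ᵥ (Vᵀ *ᵥ z)) + (s ⬝ᵥ y)⁻¹ * (s ⬝ᵥ z) ^ 2 := by
      rw [bfgsUpdate, ← hV, Matrix.add_mulVec, dotProduct_add, star_trivial,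
        ← Matrix.mulVec_mulVec, ← Matrix.mulVec_mulVec, Matrix.dotProduct_mulVec,
        ← Matrix.mulVec_transpose, Matrix.smul_mulVec, Matrix.vecMulVec_mulVec]
      simp only [dotProduct_comm z s, dotProduct_smul, op_smul_eq_smul, smul_eq_mul, sq]
    rw [hexp]
    -- If `s ⊥ z` then `Vᵀz = z` and the `H` term is positive; otherwise the square is.
    by_cases hsz : s ⬝ᵥ z = 0
    · have : Vᵀ *ᵥ z = z := by rw [hVz, hsz]; simp
      rw [this, hsz]
      simpa using hH.dotProduct_mulVec_pos hz
    · have h1 : 0 ≤ (Vᵀ *ᵥ z) ⬝ᵥ (H *ᵥ (Vᵀ *ᵥ z)) := by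
        simpa using hH.posSemidef.dotProduct_mulVec_nonneg (Vᵀ *ᵥ z)
      have h2 : 0 < (s ⬝ᵥ z) ^ 2 := by positivity
      have h3 := inv_pos.2 hsy
      have h4 := mul_pos h3 h2
      linarith

theorem Matrix.PosDef.log_det_le_trace {B : Matrix (Fin n) (Fin n) ℝ} (hB : B.PosDef) :
    Real.log B.det ≤ B.trace := by
  rw [hB.isHermitian.det_eq_prod_eigenvalues, hB.isHermitian.trace_eq_sum_eigenvalues]
  simp only [RCLike.ofReal_real_eq_id, id]
  rw [Real.log_prod fun i _ => (hB.eigenvalues_pos i).ne']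
  exact Finset.sum_le_sum fun i _ => Real.log_le_self (hB.eigenvalues_pos i).le

/-- The potential `tr H⁻¹ - log det H⁻¹`. -/
noncomputable def bfgsPotential (H : Matrix (Fin n) (Fin n) ℝ) : ℝ :=
  H⁻¹.trace - Real.log H⁻¹.det

theorem bfgsPotential_nonneg {H : Matrix (Fin n) (Fin n) ℝ} (hH : H.PosDef) :
    0 ≤ bfgsPotential H :=
  sub_nonneg.2 hH.inv.log_det_le_trace

/-- The scale `t` is uncontrolled but drops out: since `Bs = -g/t`, the trace loses `gᵀg/(te)` with
`e = -gᵀs`, and `log r ≤ r` at `r = c/(te)` absorbs the `log t⁻¹` coming from the determinant. -/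
theorem bfgsPotential_bfgsUpdate_le {s y g : Fin n → ℝ} {H : Matrix (Fin n) (Fin n) ℝ}
    {t ν M c : ℝ} (hH : H.PosDef) (ht : 0 < t) (hg : H *ᵥ g = -(t • s)) (hs : 0 < -(g ⬝ᵥ s))
    (hν : ν < 1) (hy : (1 - ν) * -(g ⬝ᵥ s) ≤ s ⬝ᵥ y) (hM : y ⬝ᵥ y ≤ M * (s ⬝ᵥ y))
    (hc : 0 < c) (hcg : c ≤ g ⬝ᵥ g) :
    bfgsPotential (bfgsUpdate s y H)
      ≤ bfgsPotential H + M - Real.log (1 - ν) - Real.log c + Real.log (-(g ⬝ᵥ s)) := by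
  have hsy : 0 < s ⬝ᵥ y := (mul_pos (sub_pos.2 hν) hs).trans_le hy
  set B := H⁻¹ with hBdef
  have hBp : B.PosDef := hH.inv
  have hT : Bᵀ = B := by
    simpa [Matrix.conjTranspose_eq_transpose_of_trivial] using hBp.isHermitian.eq
  have hu : IsUnit H.det := hH.det_pos.ne'.isUnit
  have hHB : H * B = 1 := Matrix.mul_nonsing_inv H hu
  have hBH : B * H = 1 := Matrix.nonsing_inv_mul H hu
  have hBs : B *ᵥ s = -(t⁻¹ • g) := by
    have h : B *ᵥ (H *ᵥ g) = B *ᵥ (-(t • s)) := by rw [hg]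
    rw [Matrix.mulVec_mulVec, hBH, Matrix.one_mulVec, Matrix.mulVec_neg, Matrix.mulVec_smul] at h
    rw [h, smul_neg, smul_smul, inv_mul_cancel₀ ht.ne', one_smul, neg_neg]
  set e := -(g ⬝ᵥ s) with he
  have hsBs : s ⬝ᵥ B *ᵥ s = t⁻¹ * e := by
    rw [hBs, dotProduct_neg, dotProduct_smul, dotProduct_comm s g, he, smul_eq_mul, mul_neg]
  have hBB : (B *ᵥ s) ⬝ᵥ (B *ᵥ s) = t⁻¹ ^ 2 * (g ⬝ᵥ g) := by
    rw [hBs]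
    simp
    ring
  have hti : 0 < t⁻¹ := inv_pos.2 ht
  have hsB : s ⬝ᵥ B *ᵥ s ≠ 0 := by rw [hsBs]; positivity
  have hinv : (bfgsUpdate s y H)⁻¹ = bfgsDualUpdate s y B :=
    Matrix.inv_eq_right_inv (bfgsUpdate_mul_bfgsDualUpdate hHB hT hsy.ne' hsB)
  rw [bfgsPotential, bfgsPotential, hinv, ← hBdef, trace_bfgsDualUpdate,
    det_bfgsDualUpdate hBH hT hsy.ne' hsB, hBB, hsBs,
    Real.log_mul hBp.det_pos.ne' (by positivity), Real.log_div hsy.ne' (by positivity),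
    Real.log_mul hti.ne' hs.ne']
  have h1 : (s ⬝ᵥ y)⁻¹ * (y ⬝ᵥ y) ≤ M := by
    rw [inv_mul_le_iff₀ hsy]
    linarith
  have h2 : Real.log (1 - ν) + Real.log e ≤ Real.log (s ⬝ᵥ y) := by
    rw [← Real.log_mul (sub_pos.2 hν).ne' hs.ne']
    exact Real.log_le_log (mul_pos (sub_pos.2 hν) hs) hy
  have h3 : (t⁻¹ * e)⁻¹ * (t⁻¹ ^ 2 * (g ⬝ᵥ g)) = t⁻¹ * (g ⬝ᵥ g) / e := by
    field_simp
  have h4 : t⁻¹ * c / e ≤ t⁻¹ * (g ⬝ᵥ g) / e := by gcongr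
  have h5 : Real.log (t⁻¹ * c / e) ≤ t⁻¹ * c / e := Real.log_le_self (by positivity)
  rw [Real.log_div (by positivity) hs.ne', Real.log_mul hti.ne' hc.ne'] at h5
  rw [h3]
  linarith

end Update

/-! ### Powell's theorem along a BFGS sequence. -/

section Powell

variable {n : ℕ} {f : EuclideanSpace ℝ (Fin n) → ℝ} {x : ℕ → EuclideanSpace ℝ (Fin n)}

theorem IsBFGSSequence.exists_posDef (hx : IsBFGSSequence f x) :
    ∃ μ ν : ℝ, 0 < μ ∧ ν < 1 ∧ ∃ H : ℕ → Matrix (Fin n) (Fin n) ℝ, ∀ k, (H k).PosDef ∧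
      H (k + 1) = bfgsUpdate (bfgsStep x k) (bfgsGradStep f x k) (H k) ∧
      (∃ t : ℝ, 0 < t ∧ H k *ᵥ (gradient f (x k)).ofLp = -(t • bfgsStep x k)) ∧
      0 < -((gradient f (x k)).ofLp ⬝ᵥ bfgsStep x k) ∧
      f (x (k + 1)) ≤ f (x k) + μ * ((gradient f (x k)).ofLp ⬝ᵥ bfgsStep x k) ∧
      (1 - ν) * -((gradient f (x k)).ofLp ⬝ᵥ bfgsStep x k)
        ≤ bfgsStep x k ⬝ᵥ bfgsGradStep f x k := by
  obtain ⟨hd, μ, ν, hμ, hμν, hν, H₀, hH₀, h⟩ := hx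
  have hwolfe : ∀ k, (1 - ν) * -((gradient f (x k)).ofLp ⬝ᵥ bfgsStep x k)
        ≤ bfgsStep x k ⬝ᵥ bfgsGradStep f x k := fun k => by
    have h3 := (h k).2.2
    rw [bfgsGradStep, WithLp.ofLp_sub, dotProduct_sub, dotProduct_comm (bfgsStep x k),
      dotProduct_comm (bfgsStep x k)]
    linarith
  have hdesc : ∀ k, (bfgsMatrix (bfgsStep x) (bfgsGradStep f x) H₀ k).PosDef →
      (∃ t : ℝ, 0 < t ∧ bfgsMatrix (bfgsStep x) (bfgsGradStep f x) H₀ k *ᵥ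
        (gradient f (x k)).ofLp = -(t • bfgsStep x k)) ∧
      0 < -((gradient f (x k)).ofLp ⬝ᵥ bfgsStep x k) := fun k hk => by
    obtain ⟨t, ht, hg⟩ := (h k).1
    have hg0 : (gradient f (x k)).ofLp ≠ 0 := fun h0 => (hd k).2 (by ext i; simp [h0])
    have hpos := hk.dotProduct_mulVec_pos hg0
    rw [hg, star_trivial, dotProduct_neg, dotProduct_smul, smul_eq_mul, ← mul_neg] at hpos
    -- `t = 0` would contradict `gᵀHg > 0`.
    have ht' : 0 < t := ht.lt_of_ne fun h0 => by simp [← h0] at hpos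
    exact ⟨⟨t, ht', hg⟩, pos_of_mul_pos_right hpos ht⟩
  have hpd : ∀ k, (bfgsMatrix (bfgsStep x) (bfgsGradStep f x) H₀ k).PosDef := by
    intro k
    induction k with
    | zero => exact hH₀
    | succ k ih =>
      exact posDef_bfgsUpdate ih
        ((mul_pos (sub_pos.2 hν) (hdesc k ih).2).trans_le (hwolfe k))
  exact ⟨μ, ν, hμ, hν, _, fun k => ⟨hpd k, rfl, (hdesc k (hpd k)).1, (hdesc k (hpd k)).2,
    (h k).2.1, hwolfe k⟩⟩

theorem IsBFGSSequence.antitone (hx : IsBFGSSequence f x) : Antitone (f ∘ x) := by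
  obtain ⟨μ, ν, hμ, -, H, h⟩ := hx.exists_posDef
  refine antitone_nat_of_succ_le fun k => ?_
  obtain ⟨-, -, -, hs, hA, -⟩ := h k
  have := mul_pos hμ hs
  simp only [Function.comp_apply]
  linarith

/-- Powell's theorem: the gradients along a BFGS sequence are not bounded away from zero as soon as
the values are bounded below and the ratios `yᵀy / sᵀy` are bounded above. -/
theorem IsBFGSSequence.frequently_gradient_lt (hx : IsBFGSSequence f x)
    (hf : BddBelow (Set.range (f ∘ x))) {M : ℝ}
    (hM : ∀ᶠ k in atTop, bfgsGradStep f x k ⬝ᵥ bfgsGradStep f x k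
      ≤ M * (bfgsStep x k ⬝ᵥ bfgsGradStep f x k)) {c : ℝ} (hc : 0 < c) :
    ∃ᶠ k in atTop, (gradient f (x k)).ofLp ⬝ᵥ (gradient f (x k)).ofLp < c := by
  intro hcg
  have hanti := hx.antitone
  obtain ⟨μ, ν, hμ, hν, H, h⟩ := hx.exists_posDef
  set e : ℕ → ℝ := fun k => -((gradient f (x k)).ofLp ⬝ᵥ bfgsStep x k) with he
  have hlim : Tendsto e atTop (𝓝 0) := by
    have h1 := tendsto_atTop_ciInf hanti hf
    have h2 : Tendsto (fun k => μ⁻¹ * ((f ∘ x) k - (f ∘ x) (k + 1))) atTop (𝓝 0) := by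
      simpa using (h1.sub (h1.comp (tendsto_add_atTop_nat 1))).const_mul μ⁻¹
    refine squeeze_zero (fun k => (h k).2.2.2.1.le) (fun k => ?_) h2
    rw [le_inv_mul_iff₀ hμ]
    have := (h k).2.2.2.2.1
    simp only [he, Function.comp_apply]
    linarith
  have hlog : Tendsto (fun k => Real.log (e k)) atTop atBot :=
    Real.tendsto_log_nhdsGT_zero.comp
      (tendsto_nhdsWithin_iff.2 ⟨hlim, Eventually.of_forall fun k => (h k).2.2.2.1⟩)
  have hdec : ∀ᶠ k in atTop, bfgsPotential (H (k + 1)) ≤ bfgsPotential (H k) - 1 := by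
    filter_upwards [hM, hcg,
      hlog.eventually_le_atBot (-1 - M + Real.log (1 - ν) + Real.log c)] with k hk1 hk2 hk3
    obtain ⟨hpd, hH, ⟨t, ht, hg⟩, hs, -, hy⟩ := h k
    have := bfgsPotential_bfgsUpdate_le hpd ht hg hs hν hy hk1 hc (not_lt.1 hk2)
    rw [hH]
    simp only [he] at hk3
    linarith
  obtain ⟨K, hK⟩ := eventually_atTop.1 hdec
  have hsum : ∀ j : ℕ, bfgsPotential (H (K + j)) ≤ bfgsPotential (H K) - j := by
    intro j
    induction j with
    | zero => simp
    | succ j ih =>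
      have := hK (K + j) (Nat.le_add_right _ _)
      push_cast
      rw [← add_assoc]
      linarith
  obtain ⟨j, hj⟩ := exists_nat_gt (bfgsPotential (H K))
  have h1 := hsum j
  have h2 := bfgsPotential_nonneg (h (K + j)).1
  linarith

end Powell

/-! ### The function `u² + |v|`. -/

theorem gradient_sq_add_abs {p : EuclideanSpace ℝ (Fin 2)} (hp : p 1 ≠ 0) :
    gradient (fun p : EuclideanSpace ℝ (Fin 2) => p 0 ^ 2 + |p 1|) p
      = !₂[2 * p 0, (SignType.sign (p 1) : ℝ)] := by
  have h0 : HasFDerivAt (fun p : EuclideanSpace ℝ (Fin 2) => p 0)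
    (EuclideanSpace.proj 0 : EuclideanSpace ℝ (Fin 2) →L[ℝ] ℝ) p :=
      (EuclideanSpace.proj (𝕜 := ℝ) (0 : Fin 2)).hasFDerivAt
  have h1 : HasFDerivAt (fun p : EuclideanSpace ℝ (Fin 2) => p 1)
    (EuclideanSpace.proj 1 : EuclideanSpace ℝ (Fin 2) →L[ℝ] ℝ) p :=
      (EuclideanSpace.proj (𝕜 := ℝ) (1 : Fin 2)).hasFDerivAt
  refine HasGradientAt.gradient ?_
  rw [hasGradientAt_iff_hasFDerivAt]
  refine ((h0.pow 2).add (h1.abs hp)).congr_fderiv ?_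
  ext z
  simp [EuclideanSpace.inner_eq_star_dotProduct, dotProduct, Fin.sum_univ_two]
  ring

theorem tendsto_subseq_of_frequently_abs_lt {x : ℕ → EuclideanSpace ℝ (Fin 2)} {R : ℝ}
    (hR : ∀ k, ‖x k‖ ≤ R) (h : ∀ δ > 0, ∃ᶠ k in atTop, |x k 1| < δ) :
    ∃ (φ : ℕ → ℕ) (a : EuclideanSpace ℝ (Fin 2)),
      StrictMono φ ∧ a 1 = 0 ∧ Tendsto (x ∘ φ) atTop (𝓝 a) := by
  obtain ⟨φ, hφ, hlt⟩ := extraction_forall_of_frequently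
    (fun m : ℕ => h (1 / ((m : ℝ) + 1)) Nat.one_div_pos_of_nat)
  obtain ⟨a, -, ψ, hψ, ha⟩ := (isCompact_closedBall (0 : EuclideanSpace ℝ (Fin 2)) R).tendsto_subseq
    (x := x ∘ φ) fun k => by simpa using hR (φ k)
  refine ⟨φ ∘ ψ, a, hφ.comp hψ, ?_, ha⟩
  have h1 : Tendsto (fun k => x (φ (ψ k)) 1) atTop (𝓝 (a 1)) :=
    ((EuclideanSpace.proj (𝕜 := ℝ) (1 : Fin 2)).continuous.tendsto a).comp ha
  have h2 : Tendsto (fun m => x (φ m) 1) atTop (𝓝 0) :=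
    squeeze_zero_norm (fun m => (hlt m).le) tendsto_one_div_add_atTop_nhds_zero_nat
  exact tendsto_nhds_unique h1 (h2.comp hψ.tendsto_atTop)

/-- The ratio bound of Powell's theorem for `u ^ 2 + |v|`, away from the line `v = 0`. -/
theorem sq_add_sign_sub_sign_sq_le {δ a b w : ℝ} (hδ : 0 < δ) (ha : δ ≤ |a|) (hb : δ ≤ |b|) :
    (2 * w) * (2 * w)
        + ((SignType.sign b : ℝ) - SignType.sign a) * (SignType.sign b - SignType.sign a)
      ≤ (2 + δ⁻¹) * (w * (2 * w) + (b - a) * ((SignType.sign b : ℝ) - SignType.sign a)) := by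
  have hi : 0 < δ⁻¹ := inv_pos.2 hδ
  have hii : δ⁻¹ * δ = 1 := inv_mul_cancel₀ hδ.ne'
  have hw : 0 ≤ δ⁻¹ * w ^ 2 := by positivity
  -- On a sign change the jump contributes `2² = 4` to `yᵀy` and `2|b - a| ≥ 4δ` to `sᵀy`; the
  -- factor `δ⁻¹` compensates. The summand `2` handles the `w` terms.
  have key : ∀ d : ℝ, 2 * δ ≤ d → 4 ≤ (2 + δ⁻¹) * (d * 2) := fun d hd => by
    have := mul_le_mul_of_nonneg_left hd hi.le
    nlinarith
  rcases lt_or_gt_of_ne (abs_pos.1 (hδ.trans_le ha)) with ha0 | ha0 <;>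
  rcases lt_or_gt_of_ne (abs_pos.1 (hδ.trans_le hb)) with hb0 | hb0
  · simp [sign_neg ha0, sign_neg hb0]
    linarith
  · rw [abs_of_neg ha0] at ha
    rw [abs_of_pos hb0] at hb
    have := key (b - a) (by linarith)
    simp [sign_neg ha0, sign_pos hb0]
    linarith
  · rw [abs_of_pos ha0] at ha
    rw [abs_of_neg hb0] at hb
    have := key (a - b) (by linarith)
    simp [sign_pos ha0, sign_neg hb0]
    linarith
  · simp [sign_pos ha0, sign_pos hb0]
    linarith

theorem mainTheorem7 (x : ℕ → EuclideanSpace ℝ (Fin 2))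
    (hx : IsBFGSSequence (fun p : EuclideanSpace ℝ (Fin 2) => p 0 ^ 2 + |p 1|) x) :
    ∃ (φ : ℕ → ℕ) (a : EuclideanSpace ℝ (Fin 2)),
      StrictMono φ ∧ a 1 = 0 ∧ Tendsto (x ∘ φ) atTop (𝓝 a) := by
  set f : EuclideanSpace ℝ (Fin 2) → ℝ := fun p => p 0 ^ 2 + |p 1| with hf
  have hbound : ∀ k, ‖x k‖ ≤ √(f (x 0) + f (x 0) ^ 2) := fun k => by
    have h1 : x k 0 ^ 2 + |x k 1| ≤ f (x 0) := hx.antitone (Nat.zero_le k)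
    rw [EuclideanSpace.norm_eq, Fin.sum_univ_two, Real.norm_eq_abs, Real.norm_eq_abs, sq_abs]
    refine Real.sqrt_le_sqrt (add_le_add ?_ (pow_le_pow_left₀ (abs_nonneg _) ?_ 2))
    · linarith [abs_nonneg (x k 1)]
    · linarith [sq_nonneg (x k 0)]
  refine tendsto_subseq_of_frequently_abs_lt hbound fun δ hδ hev => ?_
  simp only [not_lt] at hev
  have hbdd : BddBelow (Set.range (f ∘ x)) := ⟨0, by
    rintro _ ⟨k, rfl⟩
    simp only [hf, Function.comp_apply]
    positivity⟩
  have hne : ∀ k, δ ≤ |x k 1| → x k 1 ≠ 0 := fun k hk => abs_pos.1 (hδ.trans_le hk)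
  refine hx.frequently_gradient_lt hbdd (M := 2 + δ⁻¹) ?_ one_pos ?_
  · filter_upwards [hev, (tendsto_add_atTop_nat 1).eventually hev] with k hk hk1
    have := sq_add_sign_sub_sign_sq_le (w := x (k + 1) 0 - x k 0) hδ hk hk1
    rw [bfgsGradStep, bfgsStep, gradient_sq_add_abs (hne k hk), gradient_sq_add_abs (hne _ hk1)]
    simpa [dotProduct, Fin.sum_univ_two, ← mul_sub] using this
  · filter_upwards [hev] with k hk
    rw [gradient_sq_add_abs (hne k hk), not_lt]
    rcases lt_or_gt_of_ne (hne k hk) with h0 | h0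
    · simp [dotProduct, Fin.sum_univ_two, sign_neg h0, mul_self_nonneg]
    · simp [dotProduct, Fin.sum_univ_two, sign_pos h0, mul_self_nonneg]
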